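/- Let $\Omega\subset\mathbb R^d$ be a domain (a nonempty connected open set) with nonempty boundary $\Gamma=\partial\Omega$. Write $d_\Gamma$ for the Euclidean distance to $\Gamma$, $\Gamma_r=\{x\in\Omega: d_\Gamma(x)<r\}$ for $r>0$, and $d_H$ for the Hausdorff dimension of $\Gamma$. Assume: (1) $\Omega$ is a uniform domain (near its boundary): there are $\rho>0$ and $\sigma\ge 1$ such that any two points $x,y\in\Gamma_\rho$ are joined by a rectifiable curve $\gamma:[0,l]\to\Omega$, parametrized by arc length, with $\gamma(0)=x$, $\gamma(l)=y$, $l\le\sigma|x-y|$ and $d_\Gamma(\gamma(t))\ge\sigma^{-1}\min(t,l-t)$ for all $t\in[0,l]$. (2) $\Gamma$ is (locally uniformly) Ahlfors $s$-regular for some $s>0$: there is a regular Borel measure $\mu$ on $\Gamma$ such that for all $x_0\in\Gamma$ and $r_0>0$ there is $a>0$ with $a^{-1}r^s\le\mu(\Gamma\cap B(x;r))\le a\,r^s$ for all $x\in\Gamma\cap B(x_0;r_0)$ and all $r\in(0,2r_0)$. (3) $\delta$ is a real number with $\delta>2-(d-s)$, and the weighted Hardy inequality holds on a boundary layer: there are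 $r>0$ and $b_{\delta,r}>0$ such that $$\Big(\int_{\Gamma_r}d_\Gamma^{\,\delta}\,|\nabla\psi|^2\Big)^{1/2}\ \ge\ b_{\delta,r}\,\Big(\int_{\Gamma_r}d_\Gamma^{\,\delta-2}\,|\psi|^2\Big)^{1/2}\qquad\text{for all }\psi\in C_c^1(\Gamma_r).$$ Then $s=d_H$, and the boundary Hardy constant $$b_\delta=\sup_{r>0}\ \inf_{0\ne\psi\in C_c^1(\Gamma_r)}\ \Big(\int_{\Gamma_r}d_\Gamma^{\,\delta}\,|\nabla\psi|^2\Big)^{1/2}\Big/\Big(\int_{\Gamma_r}d_\Gamma^{\,\delta-2}\,|\psi|^2\Big)^{1/2}$$ satisfies $$b_\delta\ \le\ \frac{d-d_H+\delta-2}{2}.$$ -/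

import Mathlib

open MeasureTheory Metric Set
open scoped ENNReal

namespace BoundaryHardy

/-- Euclidean space of dimension `d`. -/
abbrev Eucl (d : ℕ) : Type := EuclideanSpace ℝ (Fin d)

/-- The Euclidean distance `d_Γ(x)` from `x` to the boundary `Γ = ∂Ω`.
(It is only used when `Γ` is nonempty.) -/
noncomputable def bdist {d : ℕ} (Ω : Set (Eucl d)) (x : Eucl d) : ℝ :=
  infDist x (frontier Ω)

/-- The boundary layer `Γ_r = {x ∈ Ω : d_Γ(x) < r}`. -/
def layer {d : ℕ} (Ω : Set (Eucl d)) (r : ℝ) : Set (Eucl d) :=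
  {x | x ∈ Ω ∧ bdist Ω x < r}

/-- `γ`, restricted to `[0, l]`, is a rectifiable curve in `Ω` from `x` to `y` which is parametrized
by arc length (hence continuous, and of length `l`), with `l ≤ σ |x - y|` and
`d_Γ(γ(t)) ≥ σ⁻¹ min(t, l - t)` for all `t ∈ [0, l]`. -/
structure IsUniformCurve {d : ℕ} (Ω : Set (Eucl d)) (σ : ℝ) (x y : Eucl d) (l : ℝ)
    (γ : ℝ → Eucl d) : Prop where
  length_nonneg : 0 ≤ l
  unitSpeed : HasUnitSpeedOn γ (Icc 0 l)
  maps : ∀ t ∈ Icc 0 l, γ t ∈ Ω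
  source : γ 0 = x
  target : γ l = y
  length_le : l ≤ σ * dist x y
  dist_ge : ∀ t ∈ Icc 0 l, σ⁻¹ * min t (l - t) ≤ bdist Ω (γ t)

/-- `Ω` is a domain (nonempty, open, connected) which is uniform near its boundary: all pairs of
points of some boundary layer are joined by uniform curves with a common constant `σ`. The curves
lie in `Ω`, but not necessarily in the boundary layer. -/
structure IsUniformDomain {d : ℕ} (Ω : Set (Eucl d)) : Prop where
  isOpen : IsOpen Ω
  isConnected : IsConnected Ω
  exists_curve : ∃ ρ : ℝ, 0 < ρ ∧ ∃ σ : ℝ, 1 ≤ σ ∧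
    ∀ x ∈ layer Ω ρ, ∀ y ∈ layer Ω ρ, ∃ (l : ℝ) (γ : ℝ → Eucl d), IsUniformCurve Ω σ x y l γ

/-- `Γ` is (locally uniformly) Ahlfors `s`-regular: there is a regular Borel measure `μ` on `Γ`
such that for each `x₀ ∈ Γ` and `r₀ > 0` there is `a > 0` with
`a⁻¹ r ^ s ≤ μ (Γ ∩ B(x; r)) ≤ a r ^ s` for all `x ∈ Γ ∩ B(x₀; r₀)` and `0 < r < 2 r₀`. -/
def IsAhlforsRegular {d : ℕ} (Γ : Set (Eucl d)) (s : ℝ) : Prop :=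
  0 < s ∧ ∃ μ : Measure (Eucl d), μ.Regular ∧ μ Γᶜ = 0 ∧
    ∀ x₀ ∈ Γ, ∀ r₀ : ℝ, 0 < r₀ → ∃ a : ℝ, 0 < a ∧
      ∀ x ∈ Γ ∩ ball x₀ r₀, ∀ r : ℝ, 0 < r → r < 2 * r₀ →
        ENNReal.ofReal (a⁻¹ * r ^ s) ≤ μ (Γ ∩ ball x r) ∧
          μ (Γ ∩ ball x r) ≤ ENNReal.ofReal (a * r ^ s)

/-- The space `C_c^1(U)`: functions of class `C^1` with compact support contained in `U`. -/
def testFunctions {d : ℕ} (U : Set (Eucl d)) : Set (Eucl d → ℝ) :=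
  {ψ | ContDiff ℝ 1 ψ ∧ HasCompactSupport ψ ∧ tsupport ψ ⊆ U}

/-- The weighted norm `‖d_Γ ^ (δ/2) ∇ψ‖₂` on `Γ_r`; the operator norm of the derivative is the
Euclidean norm of the gradient. -/
noncomputable def gradNorm {d : ℕ} (Ω : Set (Eucl d)) (δ r : ℝ) (ψ : Eucl d → ℝ) : ℝ≥0∞ :=
  (∫⁻ x in layer Ω r, ENNReal.ofReal (bdist Ω x ^ δ * ‖fderiv ℝ ψ x‖ ^ 2)) ^ (1 / 2 : ℝ)

/-- The weighted norm `‖d_Γ ^ (δ/2 - 1) ψ‖₂` on `Γ_r`. -/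
noncomputable def weightNorm {d : ℕ} (Ω : Set (Eucl d)) (δ r : ℝ) (ψ : Eucl d → ℝ) : ℝ≥0∞ :=
  (∫⁻ x in layer Ω r, ENNReal.ofReal (bdist Ω x ^ (δ - 2) * |ψ x| ^ 2)) ^ (1 / 2 : ℝ)

/-- The weighted Hardy inequality on the boundary layer `Γ_r`, with constant `b`. -/
def HardyInequality {d : ℕ} (Ω : Set (Eucl d)) (δ r b : ℝ) : Prop :=
  ∀ ψ ∈ testFunctions (layer Ω r), ENNReal.ofReal b * weightNorm Ω δ r ψ ≤ gradNorm Ω δ r ψ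

/-- The boundary Hardy constant
`b_δ = sup_{r > 0} inf {‖d_Γ ^ (δ/2) ∇ψ‖₂ / ‖d_Γ ^ (δ/2 - 1) ψ‖₂ : ψ ∈ C_c^1(Γ_r), ψ ≠ 0}`,
as an element of `[0, ∞]`. -/
noncomputable def hardyConstant {d : ℕ} (Ω : Set (Eucl d)) (δ : ℝ) : ℝ≥0∞ :=
  ⨆ (r : ℝ) (_ : 0 < r), ⨅ (ψ : Eucl d → ℝ) (_ : ψ ∈ testFunctions (layer Ω r)) (_ : ψ ≠ 0),
    gradNorm Ω δ r ψ / weightNorm Ω δ r ψ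

end BoundaryHardy

/-! Write `b` for the distance to the boundary, `p = d - s` and `β = (p + δ - 2) / 2`. Ahlfors
regularity and uniformity say that, near a boundary point, the part of `Ω` at distance about `t`
from the boundary has volume comparable with `t ^ p`: `volume_neighborhood_le` gives the upper bound
and `le_volume_shell` the lower one. The power `b ^ (-β)` is critical: `b ^ (δ - 2) * (b ^ (-β)) ^ 2
= b ^ (-p)`, whose integral over each geometric shell is of order one, hence diverges
logarithmically at the boundary.

The test functions are `b ^ (-β)`, localized near a boundary point and cut off on a logarithmic
scale after about `N` shells, with `b` replaced by a smooth 1-Lipschitz approximation. The squared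
weighted norm grows at least linearly in the number of shells. The gradient is at most `β / b` times
the function plus an error; the cut-off error has relative size `1 / N` on about `2 * N` shells and
the localization error decays geometrically, so the error stays bounded in the weighted `L²` norm.
By Minkowski the quotient is at most `β + O(N ^ (-1/2))` in every boundary layer
(`exists_testFunction`, `hardyConstant_le`).

The identity `s = d_H` is separate: a Vitali covering bounds the Hausdorff measure above, and the
mass distribution principle bounds it below. -/

namespace BoundaryHardy

/-! ### Uniform curves, the distance to the boundary, corkscrew points -/

lemma IsUniformCurve.dist_le {d : ℕ} {Ω : Set (Eucl d)} {σ : ℝ} {x y : Eucl d} {l : ℝ}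
    {γ : ℝ → Eucl d} (h : IsUniformCurve Ω σ x y l γ) {u v : ℝ} (hu : u ∈ Icc 0 l)
    (hv : v ∈ Icc 0 l) (huv : u ≤ v) : dist (γ u) (γ v) ≤ v - u := by
  have h1 := h.unitSpeed hu hv
  have h2 : edist (γ u) (γ v) ≤ eVariationOn γ (Icc 0 l ∩ Icc u v) :=
    eVariationOn.edist_le γ ⟨hu, left_mem_Icc.2 huv⟩ ⟨hv, right_mem_Icc.2 huv⟩
  rw [h1, edist_dist] at h2
  simpa using (ENNReal.ofReal_le_ofReal_iff (by simpa using huv)).1 h2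

lemma bdist_nonneg {d : ℕ} (Ω : Set (Eucl d)) (x : Eucl d) : 0 ≤ bdist Ω x := infDist_nonneg

lemma continuous_bdist {d : ℕ} (Ω : Set (Eucl d)) : Continuous (bdist Ω) :=
  continuous_infDist_pt _

lemma bdist_le_bdist_add_dist {d : ℕ} (Ω : Set (Eucl d)) (x y : Eucl d) :
    bdist Ω x ≤ bdist Ω y + dist x y := infDist_le_infDist_add_dist

lemma bdist_pos {d : ℕ} {Ω : Set (Eucl d)} (ho : IsOpen Ω) (hne : (frontier Ω).Nonempty)
    {x : Eucl d} (hx : x ∈ Ω) : 0 < bdist Ω x := by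
  refine (isClosed_frontier.notMem_iff_infDist_pos hne).1 fun h => ?_
  rw [ho.frontier_eq] at h
  exact h.2 hx

/-- A ball of radius at most the distance to the boundary stays in the set. -/
lemma ball_subset_of_le_bdist {d : ℕ} {Ω : Set (Eucl d)} (ho : IsOpen Ω) {z : Eucl d} (hz : z ∈ Ω)
    {r : ℝ} (hr : r ≤ bdist Ω z) : ball z r ⊆ Ω := by
  rcases le_or_gt r 0 with h0 | h0
  · simp [ball_eq_empty.2 h0]
  -- A point outside both `Ω` and the exterior of its closure is a frontier point, too close to `z`;
  -- so these two disjoint open sets cover the connected ball.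
  refine (convex_ball z r).isPreconnected.subset_left_of_subset_union ho
    isClosed_closure.isOpen_compl (disjoint_compl_right.mono_left subset_closure) (fun w hw => ?_)
    ⟨z, mem_ball_self h0, hz⟩
  by_contra hcon
  rw [mem_union, not_or, mem_compl_iff, not_not] at hcon
  have hf : w ∈ frontier Ω := by
    rw [ho.frontier_eq]
    exact ⟨hcon.2, hcon.1⟩
  have h2 : bdist Ω z ≤ dist z w := infDist_le_dist_of_mem hf
  rw [mem_ball, dist_comm] at hw
  linarith

/-- Interior corkscrew points: at small scales `t` there is, near every boundary point close to
`x₀`, a point of `Ω` whose distance to the boundary is comparable with `t`. -/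
lemma IsUniformDomain.exists_corkscrew {d : ℕ} {Ω : Set (Eucl d)} (hΩ : IsUniformDomain Ω)
    {x₀ : Eucl d} (hx₀ : x₀ ∈ frontier Ω) :
    ∃ σ : ℝ, 1 ≤ σ ∧ ∃ R₀ : ℝ, 0 < R₀ ∧ ∀ y ∈ frontier Ω ∩ ball x₀ R₀, ∀ t : ℝ, 0 < t → t < R₀ →
      ∃ z ∈ Ω, dist z y ≤ 2 * σ * t ∧ t / (4 * σ) ≤ bdist Ω z := by
  obtain ⟨ρ, hρ, σ, hσ, hcurve⟩ := hΩ.exists_curve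
  obtain ⟨p, hp⟩ := hΩ.isConnected.nonempty
  have hpx : 0 < dist p x₀ := by
    refine dist_pos.2 fun h => ?_
    rw [hΩ.isOpen.frontier_eq] at hx₀
    exact hx₀.2 (h ▸ hp)
  -- Below `ρ` the points chosen near `y` lie in the layer where uniform curves exist; below `dist p
  -- x₀ / 2` the fixed point `p` is farther than `t` from `y`.
  refine ⟨σ, hσ, min ρ (dist p x₀ / 2), by positivity, fun y hy t ht htR => ?_⟩
  have htρ := htR.trans_le (min_le_left _ _)
  have htp := htR.trans_le (min_le_right _ _)
  have hyx := (mem_ball.1 hy.2).trans_le (min_le_right _ _)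
  have hpy : t < dist p y := by
    have := dist_triangle p y x₀
    linarith
  obtain ⟨x, hx, hxy⟩ := Metric.mem_closure_iff.1 (frontier_subset_closure hy.1) (t / 2)
    (by positivity)
  rw [dist_comm] at hxy
  -- By connectedness `Ω` has a point at distance exactly `t` from `y`. Joined to `x`, which is
  -- within `t / 2` of `y`, it gives a curve of length at least `t / 2`, and the midpoint of that
  -- curve is the corkscrew point.
  obtain ⟨x', hx', hx'y⟩ : t ∈ (fun w => dist w y) '' Ω :=
    hΩ.isConnected.isPreconnected.intermediate_value hx hp (by fun_prop) ⟨by linarith, hpy.le⟩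
  simp only at hx'y
  have hb : ∀ w, bdist Ω w ≤ dist w y := fun w => infDist_le_dist_of_mem hy.1
  obtain ⟨l, γ, h⟩ := hcurve x ⟨hx, by linarith [hb x]⟩ x' ⟨hx', by linarith [hb x']⟩
  have h0 : (0 : ℝ) ∈ Icc 0 l := ⟨le_rfl, h.length_nonneg⟩
  have hl : l ∈ Icc 0 l := ⟨h.length_nonneg, le_rfl⟩
  have hm : l / 2 ∈ Icc 0 l := ⟨by linarith [h.length_nonneg], by linarith [h.length_nonneg]⟩
  have hxx' := h.dist_le h0 hl h.length_nonneg
  rw [h.source, h.target] at hxx'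
  have h1 : t / 2 ≤ l := by
    have := dist_triangle_left x' y x
    linarith
  have h2 : dist x x' ≤ 3 / 2 * t := by
    have := dist_triangle_right x x' y
    linarith
  have h3 : l ≤ σ * (3 / 2 * t) := h.length_le.trans (by gcongr)
  refine ⟨γ (l / 2), h.maps _ hm, ?_, ?_⟩
  · have h4 := h.dist_le h0 hm hm.1
    rw [h.source] at h4
    have h5 := dist_triangle_left (γ (l / 2)) y x
    nlinarith
  · refine le_trans ?_ (h.dist_ge _ hm)
    rw [min_eq_left (by linarith), div_eq_inv_mul, mul_inv, mul_comm (4⁻¹ : ℝ), mul_assoc]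
    have : 0 ≤ σ⁻¹ := by positivity
    gcongr
    linarith

/-! ### Volumes of neighbourhoods and shells of the boundary -/

lemma volume_ball_eq {d : ℕ} (x : Eucl d) {r : ℝ} (hr : 0 < r) :
    volume (ball x r) = ENNReal.ofReal (r ^ d) * volume (ball (0 : Eucl d) 1) := by
  simpa using Measure.addHaar_ball_of_pos volume x hr

lemma measurableSet_dist_lt {d : ℕ} (r : ℝ) :
    MeasurableSet {p : Eucl d × Eucl d | dist p.1 p.2 < r} :=
  (isOpen_lt (by fun_prop) (by fun_prop)).measurableSet

/-- Double counting of the pairs of points at distance less than `r`. -/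
lemma setLIntegral_measure_ball_comm {d : ℕ} (μ ν : Measure (Eucl d)) [SFinite μ] [SFinite ν]
    (A B : Set (Eucl d)) (r : ℝ) :
    ∫⁻ x in A, ν (B ∩ ball x r) ∂μ = ∫⁻ y in B, μ (A ∩ ball y r) ∂ν := by
  have h1 : ∀ x, ν (B ∩ ball x r) = ∫⁻ y in B, {p : Eucl d × Eucl d | dist p.1 p.2 < r}.indicator
      1 (x, y) ∂ν := fun x => by
    have : (fun y => {p : Eucl d × Eucl d | dist p.1 p.2 < r}.indicator (1 : Eucl d × Eucl d → ℝ≥0∞) (x, y))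
        = (ball x r).indicator 1 := by
      ext y; simp [indicator, dist_comm]
    rw [this, lintegral_indicator_one measurableSet_ball, Measure.restrict_apply measurableSet_ball,
      inter_comm]
  have h2 : ∀ y, μ (A ∩ ball y r) = ∫⁻ x in A, {p : Eucl d × Eucl d | dist p.1 p.2 < r}.indicator
      1 (x, y) ∂μ := fun y => by
    have : (fun x => {p : Eucl d × Eucl d | dist p.1 p.2 < r}.indicator (1 : Eucl d × Eucl d → ℝ≥0∞) (x, y))
        = (ball y r).indicator 1 := by
      ext x; simp [indicator]
    rw [this, lintegral_indicator_one measurableSet_ball, Measure.restrict_apply measurableSet_ball,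
      inter_comm]
  simp_rw [h1, h2]
  exact lintegral_lintegral_swap
    ((measurable_one.indicator (measurableSet_dist_lt r)).aemeasurable)

/-- The volume of a neighbourhood of a piece of an Ahlfors regular set. -/
lemma IsAhlforsRegular.volume_neighborhood_le {d : ℕ} {Γ : Set (Eucl d)} {s : ℝ}
    (h : IsAhlforsRegular Γ s) (hΓ : IsClosed Γ) {x₀ : Eucl d} (hx₀ : x₀ ∈ Γ) {R T : ℝ}
    (hR : 0 < R) (hT : 0 < T) :
    ∃ A : ℝ, 0 < A ∧ ∀ t : ℝ, 0 < t → t < T →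
      volume {x ∈ ball x₀ R | infDist x Γ < t} ≤ ENNReal.ofReal (A * t ^ ((d : ℝ) - s)) := by
  obtain ⟨hs, μ, hμ, -, hreg⟩ := h
  obtain ⟨a, ha, hreg⟩ := hreg x₀ hx₀ (2 * (R + T)) (by positivity)
  set ω := (volume (ball (0 : Eucl d) 1)).toReal with hω
  have hω0 : 0 < ω := ENNReal.toReal_pos (measure_ball_pos _ _ one_pos).ne' measure_ball_lt_top.ne
  refine ⟨a * (a * (2 * (R + T)) ^ s * 2 ^ d * ω), by positivity, fun t ht htT => ?_⟩
  set E := {x ∈ ball x₀ R | infDist x Γ < t}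
  have hE : MeasurableSet E := measurableSet_ball.inter
    (isOpen_lt (continuous_infDist_pt _) continuous_const).measurableSet
  set B := Γ ∩ ball x₀ (2 * (R + T))
  have hB : MeasurableSet B := hΓ.measurableSet.inter measurableSet_ball
  -- Each point of `E` is within `t` of some `y ∈ Γ`, so its ball of radius `2 * t` contains `ball y
  -- t`, of mass at least `a⁻¹ * t ^ s`. Conversely each `y` sees only a volume of order `t ^ d`.
  have key := setLIntegral_measure_ball_comm volume μ E B (2 * t)
  have lower : ENNReal.ofReal (a⁻¹ * t ^ s) * volume E ≤ ∫⁻ x in E, μ (B ∩ ball x (2 * t)) := by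
    rw [← setLIntegral_const]
    refine setLIntegral_mono' hE fun x hx => ?_
    obtain ⟨y, hy, hxy⟩ := (infDist_lt_iff ⟨x₀, hx₀⟩).1 hx.2
    have hxR := mem_ball.1 hx.1
    have hyx₀ : dist y x₀ < R + T := by
      have := dist_triangle_left y x₀ x
      linarith
    refine (hreg y ⟨hy, by rw [mem_ball]; linarith⟩ t ht (by linarith)).1.trans
      (measure_mono fun z hz => ⟨⟨hz.1, ?_⟩, ?_⟩)
    · have h1 := mem_ball.1 hz.2
      have := dist_triangle z y x₀
      rw [mem_ball]; linarith
    · have h1 := mem_ball.1 hz.2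
      have := dist_triangle_right z x y
      rw [mem_ball]; linarith
  have upper : ∫⁻ y in B, volume (E ∩ ball y (2 * t)) ∂μ ≤
      ENNReal.ofReal ((2 * t) ^ d * ω) * ENNReal.ofReal (a * (2 * (R + T)) ^ s) := by
    calc _ ≤ ∫⁻ y in B, ENNReal.ofReal ((2 * t) ^ d * ω) ∂μ := by
          refine lintegral_mono fun y => (measure_mono inter_subset_right).trans ?_
          rw [volume_ball_eq y (by positivity), ENNReal.ofReal_mul (by positivity),
            ENNReal.ofReal_toReal measure_ball_lt_top.ne]
      _ ≤ _ := by
          rw [setLIntegral_const]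
          gcongr
          exact (hreg x₀ ⟨hx₀, mem_ball_self (by positivity)⟩ _ (by positivity)
            (by linarith)).2
  have hfin := lower.trans (key.le.trans upper)
  rw [← ENNReal.ofReal_mul (by positivity)] at hfin
  have hc : 0 < a⁻¹ * t ^ s := by positivity
  rw [mul_comm, ← ENNReal.le_div_iff_mul_le (Or.inl (by simpa using hc)) (Or.inl ENNReal.ofReal_ne_top),
    ← ENNReal.ofReal_div_of_pos hc] at hfin
  refine hfin.trans_eq ?_
  congr 1
  rw [Real.rpow_sub ht, Real.rpow_natCast, mul_pow]
  field_simp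

/-- In a uniform domain with Ahlfors regular boundary, the shells around the boundary are not too
small. -/
lemma IsUniformDomain.le_volume_shell {d : ℕ} {Ω : Set (Eucl d)} (hΩ : IsUniformDomain Ω) {s : ℝ}
    (h : IsAhlforsRegular (frontier Ω) s) {x₀ : Eucl d} (hx₀ : x₀ ∈ frontier Ω) :
    ∃ σ : ℝ, 1 ≤ σ ∧ ∃ R₀ : ℝ, 0 < R₀ ∧ ∀ R : ℝ, 0 < R → R ≤ R₀ → ∃ c : ℝ, 0 < c ∧
      ∀ t : ℝ, 0 < t → t < R → ENNReal.ofReal (c * t ^ ((d : ℝ) - s)) ≤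
        volume {x ∈ Ω ∩ ball x₀ (4 * σ * R) |
          t / (8 * σ) ≤ bdist Ω x ∧ bdist Ω x ≤ 3 * σ * t} := by
  obtain ⟨σ, hσ, R₀, hR₀, hcork⟩ := hΩ.exists_corkscrew hx₀
  have hσ0 : 0 < σ := by linarith
  refine ⟨σ, hσ, R₀, hR₀, fun R hR hRR₀ => ?_⟩
  obtain ⟨hs, μ, hμ, -, hreg⟩ := h
  obtain ⟨a, ha, hreg⟩ := hreg x₀ hx₀ (8 * σ * R) (by positivity)
  set ω := (volume (ball (0 : Eucl d) 1)).toReal with hω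
  have hω0 : 0 < ω := ENNReal.toReal_pos (measure_ball_pos _ _ one_pos).ne' measure_ball_lt_top.ne
  refine ⟨(a * (6 * σ) ^ s)⁻¹ * ((1 / (8 * σ)) ^ d * ω * (a⁻¹ * R ^ s)), by positivity,
    fun t ht htR => ?_⟩
  set E := {x ∈ Ω ∩ ball x₀ (4 * σ * R) | t / (8 * σ) ≤ bdist Ω x ∧ bdist Ω x ≤ 3 * σ * t}
  have hE : MeasurableSet E := (hΩ.isOpen.measurableSet.inter measurableSet_ball).inter
    ((isClosed_le continuous_const (continuous_bdist Ω)).inter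
      (isClosed_le (continuous_bdist Ω) continuous_const)).measurableSet
  set B := frontier Ω ∩ ball x₀ R
  have hB : MeasurableSet B := isClosed_frontier.measurableSet.inter measurableSet_ball
  have hσR : R ≤ σ * R := by nlinarith
  have hσt : t ≤ σ * t := by nlinarith
  -- The same count in the other direction: every boundary point sees a corkscrew ball inside `E`,
  -- and every point of `E` sees boundary mass at most of order `t ^ s`.
  have key := setLIntegral_measure_ball_comm μ volume B E (3 * σ * t)
  have lower : ENNReal.ofReal ((t / (8 * σ)) ^ d * ω) * ENNReal.ofReal (a⁻¹ * R ^ s) ≤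
      ∫⁻ y in B, volume (E ∩ ball y (3 * σ * t)) ∂μ := by
    calc _ ≤ ENNReal.ofReal ((t / (8 * σ)) ^ d * ω) * μ B := by
          gcongr
          exact (hreg x₀ ⟨hx₀, mem_ball_self (by positivity)⟩ R hR (by nlinarith)).1
      _ ≤ _ := by
          rw [← setLIntegral_const]
          refine setLIntegral_mono' hB fun y hy => ?_
          obtain ⟨z, hz, hzy, hbz⟩ := hcork y ⟨hy.1, ball_subset_ball hRR₀ hy.2⟩ t ht
            (htR.trans_le hRR₀)
          -- The ball has half the radius allowed by the corkscrew condition, so its points keep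
          -- distance at least `t / (8 * σ)` from the boundary.
          have e1 : t / (4 * σ) = t / (8 * σ) + t / (8 * σ) := by field_simp; norm_num
          have e2 : t / (8 * σ) ≤ t / 8 := by gcongr; linarith
          have e3 : 0 < t / (8 * σ) := by positivity
          have := volume_ball_eq z e3
          rw [ENNReal.ofReal_mul (by positivity), ENNReal.ofReal_toReal measure_ball_lt_top.ne,
            ← this]
          refine measure_mono fun w hw => ?_
          have hw' := mem_ball.1 hw
          have hwy : dist w y < 3 * σ * t := by
            have := dist_triangle w z y
            linarith
          refine ⟨⟨⟨ball_subset_of_le_bdist hΩ.isOpen hz (by linarith) hw, ?_⟩, ?_, ?_⟩, hwy⟩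
          · have h1 := dist_triangle w y x₀
            have h2 := mem_ball.1 hy.2
            have h3 : σ * t ≤ σ * R := by gcongr
            rw [mem_ball]; linarith
          · have := bdist_le_bdist_add_dist Ω z w
            rw [dist_comm] at this
            linarith
          · exact (infDist_le_dist_of_mem hy.1).trans hwy.le
  have upper : ∫⁻ x in E, μ (B ∩ ball x (3 * σ * t)) ≤
      ENNReal.ofReal (a * (6 * σ * t) ^ s) * volume E := by
    rw [← setLIntegral_const]
    refine lintegral_mono fun x => ?_
    rcases (B ∩ ball x (3 * σ * t)).eq_empty_or_nonempty with h0 | ⟨y, hy, hyx⟩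
    · simp [h0]
    · have h3 : σ * t < σ * R := by gcongr
      -- Regularity holds only at points of the boundary, so the ball is recentred at `y` with
      -- doubled radius.
      refine le_trans (measure_mono ?_) (hreg y ⟨hy.1, ball_subset_ball (by linarith) hy.2⟩
        (6 * σ * t) (by positivity) (by linarith)).2
      refine fun z hz => ⟨hz.1.1, ?_⟩
      have h1 := mem_ball.1 hyx
      have h2 := mem_ball.1 hz.2
      have := dist_triangle_right z y x
      rw [mem_ball]; linarith
  have hfin := lower.trans (key.le.trans upper)
  rw [← ENNReal.ofReal_mul (by positivity)] at hfin
  have hc : 0 < a * (6 * σ * t) ^ s := by positivity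
  rw [mul_comm (ENNReal.ofReal _), ← ENNReal.div_le_iff_le_mul (Or.inl (by simpa using hc))
    (Or.inl ENNReal.ofReal_ne_top), ← ENNReal.ofReal_div_of_pos hc] at hfin
  refine le_trans (le_of_eq ?_) hfin
  congr 1
  rw [Real.rpow_sub ht, Real.rpow_natCast, Real.mul_rpow (by positivity) ht.le, div_pow,
    div_pow, one_pow]
  field_simp

/-! ### Hausdorff dimension of the boundary -/

open Filter Topology Measure in
/-- A regular set has locally finite Hausdorff measure of the right dimension. -/
lemma IsAhlforsRegular.hausdorffMeasure_ne_top {d : ℕ} {Γ : Set (Eucl d)} {s : ℝ}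
    (h : IsAhlforsRegular Γ s) (hΓ : IsClosed Γ) {x₀ : Eucl d} (hx₀ : x₀ ∈ Γ) {R : ℝ}
    (hR : 0 < R) : μH[s] (Γ ∩ ball x₀ R) ≠ ∞ := by
  obtain ⟨hs, μ, hμ, -, hreg⟩ := h
  obtain ⟨a, ha, hreg⟩ := hreg x₀ hx₀ (2 * R) (by positivity)
  set B := Γ ∩ ball x₀ R
  -- The small balls are disjoint, so their `μ`-masses add up to at most that of one large ball; the
  -- fourfold enlargements cover `B`, and their diameters to the power `s` are controlled by these
  -- masses.
  have hdisj : ∀ n : ℕ, ∃ u ⊆ B, (u.PairwiseDisjoint fun x => closedBall x (R / (n + 1))) ∧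
      ∀ x ∈ B, ∃ y ∈ u, closedBall x (R / (n + 1)) ⊆ closedBall y (4 * (R / (n + 1))) := fun n =>
    Vitali.exists_disjoint_subfamily_covering_enlargement_closedBall B id
      (fun _ => R / (n + 1)) (R / (n + 1)) (fun _ _ => le_rfl) 4 (by norm_num)
  choose u huB hud huc using hdisj
  have hρ : ∀ n : ℕ, 0 < R / (n + 1) := fun n => by positivity
  have hcount : ∀ n, Countable (u n) := fun n =>
    ((hud n).countable_of_nonempty_interior fun x _ =>
      ⟨x, ball_subset_interior_closedBall (mem_ball_self (hρ n))⟩).to_subtype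
  have hle : ∀ n, ∑' x : u n, ediam (closedBall (x : Eucl d) (4 * (R / (n + 1)))) ^ s ≤
      ENNReal.ofReal (8 ^ s * a) * μ (Γ ∩ ball x₀ (3 * R)) := fun n => by
    have hρR : R / (n + 1) ≤ R := div_le_self hR.le (by linarith [n.cast_nonneg (α := ℝ)])
    calc _ ≤ ∑' x : u n, ENNReal.ofReal (8 ^ s * a) *
            μ (Γ ∩ closedBall (x : Eucl d) (R / (n + 1))) := by
          refine ENNReal.tsum_le_tsum fun x => ?_
          have hx := huB n x.2
          have h1 := (hreg x ⟨hx.1, ball_subset_ball (by linarith) hx.2⟩ _ (hρ n)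
            (by linarith)).1
          calc _ ≤ ENNReal.ofReal (8 * (R / (n + 1))) ^ s := by
                gcongr
                refine ediam_le fun p hp q hq => ?_
                rw [edist_dist]
                apply ENNReal.ofReal_le_ofReal
                have := dist_triangle_right p q (x : Eucl d)
                rw [mem_closedBall] at hp hq
                linarith
            _ = ENNReal.ofReal (8 ^ s * a) * ENNReal.ofReal (a⁻¹ * (R / (n + 1)) ^ s) := by
                rw [ENNReal.ofReal_rpow_of_pos (by have := hρ n; positivity),
                  ← ENNReal.ofReal_mul (by positivity), Real.mul_rpow (by norm_num) (hρ n).le]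
                congr 1
                field_simp
            _ ≤ _ := by
                gcongr
                exact h1.trans (measure_mono (inter_subset_inter_right _ ball_subset_closedBall))
      _ = ENNReal.ofReal (8 ^ s * a) *
            ∑' x : u n, μ (Γ ∩ closedBall (x : Eucl d) (R / (n + 1))) := ENNReal.tsum_mul_left
      _ ≤ _ := by
          gcongr
          refine (tsum_meas_le_meas_iUnion_of_disjoint μ
            (fun x => hΓ.measurableSet.inter measurableSet_closedBall) ?_).trans
            (measure_mono ?_)
          · intro x y hxy
            exact ((hud n) x.2 y.2 (Subtype.coe_injective.ne hxy)).mono inter_subset_right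
              inter_subset_right
          · refine iUnion_subset fun x z hz => ⟨hz.1, ?_⟩
            have h1 := mem_closedBall.1 hz.2
            have h2 := mem_ball.1 (huB n x.2).2
            have := dist_triangle z x x₀
            rw [mem_ball]
            linarith
  have hlim : Tendsto (fun n : ℕ => ENNReal.ofReal (8 * (R / (n + 1)))) atTop (𝓝 0) := by
    have := (tendsto_one_div_add_atTop_nhds_zero_nat (𝕜 := ℝ)).const_mul (8 * R)
    rw [mul_zero] at this
    have h2 := ENNReal.tendsto_ofReal this
    rw [ENNReal.ofReal_zero] at h2
    refine h2.congr fun n => ?_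
    congr 1
    ring
  have hmain := hausdorffMeasure_le_liminf_tsum (ι := fun n => u n) s B
    (fun n : ℕ => ENNReal.ofReal (8 * (R / (n + 1)))) hlim
    (fun n x => closedBall (x : Eucl d) (4 * (R / (n + 1))))
    (Eventually.of_forall fun n x => by
      refine ediam_le fun p hp q hq => ?_
      rw [edist_dist]
      apply ENNReal.ofReal_le_ofReal
      have := dist_triangle_right p q (x : Eucl d)
      rw [mem_closedBall] at hp hq
      linarith)
    (Eventually.of_forall fun n x hx => by
      obtain ⟨y, hy, hxy⟩ := huc n x hx
      exact mem_iUnion.2 ⟨⟨y, hy⟩, hxy (mem_closedBall_self (hρ n).le)⟩)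
  refine ne_top_of_le_ne_top ?_ (hmain.trans ((liminf_le_liminf
    (Eventually.of_forall hle)).trans (liminf_const _).le))
  refine ENNReal.mul_ne_top ENNReal.ofReal_ne_top ?_
  exact ne_top_of_le_ne_top ENNReal.ofReal_ne_top
    (hreg x₀ ⟨hx₀, mem_ball_self (by positivity)⟩ (3 * R) (by positivity) (by linarith)).2

-- Mass distribution principle: `μ (A ∩ B) ≤ a * diam A ^ s` for small `A`, so the Hausdorff measure
-- dominates a multiple of `μ`, which charges `B`.
open Filter Topology Measure in
lemma IsAhlforsRegular.hausdorffMeasure_ne_zero {d : ℕ} {Γ : Set (Eucl d)} {s : ℝ}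
    (h : IsAhlforsRegular Γ s) (hΓ : IsClosed Γ) {x₀ : Eucl d} (hx₀ : x₀ ∈ Γ) :
    μH[s] Γ ≠ 0 := by
  obtain ⟨hs, μ, hμ, -, hreg⟩ := h
  obtain ⟨a, ha, hreg⟩ := hreg x₀ hx₀ 1 one_pos
  set B := Γ ∩ ball x₀ 1
  have hB : MeasurableSet B := hΓ.measurableSet.inter measurableSet_ball
  have hle : ENNReal.ofReal a⁻¹ • μ.restrict B ≤ μH[s] := by
    refine le_hausdorffMeasure s _ 1 one_pos fun A hA => ?_
    have hfin : ediam A ≠ ∞ := ne_top_of_le_ne_top ENNReal.one_ne_top hA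
    rw [Measure.smul_apply, smul_eq_mul, Measure.restrict_apply' hB]
    rcases (A ∩ B).eq_empty_or_nonempty with h0 | ⟨y, hyA, hyB⟩
    · simp [h0]
    have hD : (ediam A).toReal ≤ 1 := ENNReal.toReal_le_of_le_ofReal zero_le_one (by simpa using hA)
    -- An open ball containing `A` needs a radius strictly larger than the diameter; the radius then
    -- decreases to the diameter, which also covers diameter zero.
    have hbound : ∀ r : ℝ, (ediam A).toReal < r → r < 2 →
        ENNReal.ofReal a⁻¹ * μ (A ∩ B) ≤ ENNReal.ofReal (r ^ s) := fun r hr hr2 => by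
      have hr0 : 0 < r := ENNReal.toReal_nonneg.trans_lt hr
      calc _ ≤ ENNReal.ofReal a⁻¹ * ENNReal.ofReal (a * r ^ s) := by
            gcongr
            refine (measure_mono ?_).trans (hreg y hyB r hr0 (by linarith)).2
            refine fun z hz => ⟨hz.2.1, ?_⟩
            rw [mem_ball, dist_edist]
            exact (ENNReal.toReal_mono hfin (edist_le_ediam_of_mem hz.1 hyA)).trans_lt hr
        _ = _ := by
            rw [← ENNReal.ofReal_mul (by positivity)]
            congr 1
            field_simp
    have hlim : Tendsto (fun r : ℝ => ENNReal.ofReal (r ^ s)) (𝓝[>] (ediam A).toReal)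
        (𝓝 (ENNReal.ofReal ((ediam A).toReal ^ s))) := by
      refine ENNReal.tendsto_ofReal (Tendsto.mono_left ?_ nhdsWithin_le_nhds)
      exact (Real.continuousAt_rpow_const _ _ (Or.inr hs.le)).tendsto
    rw [← ENNReal.ofReal_rpow_of_nonneg ENNReal.toReal_nonneg hs.le, ENNReal.ofReal_toReal hfin]
      at hlim
    refine ge_of_tendsto hlim ?_
    filter_upwards [Ioo_mem_nhdsGT (show (ediam A).toReal < 2 by linarith)] with r hr
    exact hbound r hr.1 hr.2
  intro h0
  have h1 := hle Γ
  rw [h0, Measure.smul_apply, smul_eq_mul, Measure.restrict_apply' hB,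
    inter_eq_right.2 (inter_subset_left)] at h1
  have h2 := (hreg x₀ ⟨hx₀, mem_ball_self one_pos⟩ 1 one_pos (by norm_num)).1
  have h3 : 0 < μ B := lt_of_lt_of_le (by simp [ha]) h2
  have h4 : 0 < ENNReal.ofReal a⁻¹ := by simp [ha]
  exact (ENNReal.mul_pos h4.ne' h3.ne').not_ge h1

/-- The dimension of a closed Ahlfors regular set is its regularity exponent. -/
lemma IsAhlforsRegular.dimH_eq {d : ℕ} {Γ : Set (Eucl d)} {s : ℝ}
    (h : IsAhlforsRegular Γ s) (hΓ : IsClosed Γ) (hne : Γ.Nonempty) :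
    dimH Γ = ENNReal.ofReal s := by
  obtain ⟨x₀, hx₀⟩ := hne
  have hs : ((s.toNNReal : NNReal) : ℝ) = s := Real.coe_toNNReal s h.1.le
  refine le_antisymm ?_ (le_dimH_of_hausdorffMeasure_ne_zero
    (by rw [hs]; exact h.hausdorffMeasure_ne_zero hΓ hx₀))
  have hU : Γ = ⋃ n : ℕ, Γ ∩ ball x₀ (n + 1) := by
    rw [← inter_iUnion, eq_comm, inter_eq_left]
    intro x _
    obtain ⟨n, hn⟩ := exists_nat_gt (dist x x₀)
    exact mem_iUnion.2 ⟨n, by rw [mem_ball]; linarith⟩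
  rw [hU, dimH_iUnion]
  refine iSup_le fun n => dimH_le_of_hausdorffMeasure_ne_top ?_
  rw [hs]
  exact h.hausdorffMeasure_ne_top hΓ hx₀ (by positivity)

/-! ### Smoothed distance and logarithmic cut-off -/

open Convolution in
/-- Mollification of a Lipschitz function: a smooth, still 1-Lipschitz, uniform approximation. -/
lemma exists_contDiff_approx {d : ℕ} {f : Eucl d → ℝ} (hf : LipschitzWith 1 f) {h : ℝ}
    (hh : 0 < h) : ∃ D : Eucl d → ℝ, ContDiff ℝ 1 D ∧ (∀ x, |D x - f x| ≤ h) ∧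
      ∀ x, ‖fderiv ℝ D x‖ ≤ 1 := by
  let φ : ContDiffBump (0 : Eucl d) := ⟨h / 2, h, by positivity, by linarith⟩
  have hloc : LocallyIntegrable f volume := hf.continuous.locallyIntegrable
  have hex : ConvolutionExists (φ.normed volume) f (ContinuousLinearMap.lsmul ℝ ℝ) volume :=
    φ.hasCompactSupport_normed.convolutionExists_left _ φ.continuous_normed hloc
  refine ⟨φ.normed volume ⋆[ContinuousLinearMap.lsmul ℝ ℝ, volume] f,
    φ.hasCompactSupport_normed.contDiff_convolution_left (n := 1) _ φ.contDiff_normed hloc,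
    fun x => ?_, fun x => ?_⟩
  · rw [← Real.dist_eq]
    refine φ.dist_normed_convolution_le hf.continuous.aestronglyMeasurable fun y hy => ?_
    have := hf.dist_le_mul y x
    rw [NNReal.coe_one, one_mul] at this
    exact this.trans (mem_ball.1 hy).le
  · refine norm_fderiv_le_of_lipschitz (C := 1) ℝ (LipschitzWith.of_dist_le_mul fun x y => ?_)
    rw [Real.dist_eq, convolution_def, convolution_def, ← integral_sub (hex x) (hex y),
      ← Real.norm_eq_abs]
    -- The kernel is nonnegative with integral one, so averaging preserves the Lipschitz constant.
    have hint : Integrable (fun t => φ.normed volume t * dist x y) volume :=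
      φ.integrable_normed.mul_const _
    refine (norm_integral_le_of_norm_le hint (Filter.Eventually.of_forall fun t => ?_)).trans_eq ?_
    · simp only [ContinuousLinearMap.lsmul_apply, smul_eq_mul]
      rw [← mul_sub, norm_mul, Real.norm_of_nonneg (φ.nonneg_normed t), ← dist_eq_norm]
      have := hf.dist_le_mul (x - t) (y - t)
      rw [NNReal.coe_one, one_mul, dist_sub_right] at this
      exact mul_le_mul_of_nonneg_left this (φ.nonneg_normed t)
    · rw [integral_mul_const, φ.integral_normed, NNReal.coe_one]

lemma lipschitzWith_bdist {d : ℕ} (Ω : Set (Eucl d)) : LipschitzWith 1 (bdist Ω) :=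
  lipschitz_infDist_pt _

/-- The power `t ^ (-β)`, cut off by the profile `g` on the logarithmic scale `M`. -/
noncomputable def profile (g : ℝ → ℝ) (β M t : ℝ) : ℝ := t ^ (-β) * g (Real.log t / M)

lemma hasDerivAt_profile {g : ℝ → ℝ} (hg : Differentiable ℝ g) (β M : ℝ) {t : ℝ} (ht : 0 < t) :
    HasDerivAt (profile g β M)
      (-β * t ^ (-β - 1) * g (Real.log t / M) +
        t ^ (-β) * (deriv g (Real.log t / M) * (t⁻¹ / M))) t := by
  have h1 : HasDerivAt (fun t : ℝ => t ^ (-β)) (-β * t ^ (-β - 1)) t :=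
    Real.hasDerivAt_rpow_const (Or.inl ht.ne')
  have h2 : HasDerivAt (fun t : ℝ => g (Real.log t / M))
      (deriv g (Real.log t / M) * (t⁻¹ / M)) t :=
    (hg _).hasDerivAt.comp t ((Real.hasDerivAt_log ht.ne').div_const M)
  exact h1.mul h2

/-- The first term carries the sharp constant `β`. The second comes from the cut-off and gains `1 /
M`, since `g` varies on the logarithmic scale `M`. -/
lemma abs_deriv_profile_le {g : ℝ → ℝ} (hg : Differentiable ℝ g) {β M C : ℝ} (hβ : 0 ≤ β)
    (hM : 0 < M) (hC : ∀ v, |deriv g v| ≤ C) {t : ℝ} (ht : 0 < t) :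
    |deriv (profile g β M) t| ≤ t⁻¹ * (β * |profile g β M t| + C / M * t ^ (-β)) := by
  rw [(hasDerivAt_profile hg β M ht).deriv]
  have h0 : 0 < t ^ (-β) := Real.rpow_pos_of_pos ht _
  refine (abs_add_le _ _).trans (le_of_le_of_eq (add_le_add (le_of_eq ?_)
    (?_ : _ ≤ t⁻¹ * (C / M * t ^ (-β)))) (mul_add _ _ _).symm)
  · rw [profile, abs_mul, abs_mul, abs_mul, abs_neg, abs_of_nonneg hβ, Real.rpow_sub_one ht.ne',
      abs_of_pos h0, abs_of_pos (div_pos h0 ht)]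
    ring
  · rw [abs_mul, abs_mul, abs_of_pos h0, abs_of_pos (div_pos (inv_pos.2 ht) hM)]
    calc _ ≤ t ^ (-β) * (C * (t⁻¹ / M)) := by gcongr; exact hC _
      _ = _ := by ring

lemma contDiffAt_profile {g : ℝ → ℝ} (hg : ContDiff ℝ 1 g) (β M : ℝ) {t : ℝ} (ht : 0 < t) :
    ContDiffAt ℝ 1 (profile g β M) t := by
  refine (Real.contDiffAt_rpow_const_of_ne ht.ne').mul (hg.contDiffAt.comp t ?_)
  exact (Real.contDiffAt_log.2 ht.ne').div_const M

/-- The cut-off function `η · profile (D)`, extended by zero outside `Ω`. -/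
noncomputable def cutoff {d : ℕ} (Ω : Set (Eucl d)) (η D : Eucl d → ℝ) (g : ℝ → ℝ) (β M : ℝ) :
    Eucl d → ℝ :=
  Ω.indicator fun x => η x * profile g β M (D x)

section cutoff

variable {d : ℕ} {Ω : Set (Eucl d)} {η D : Eucl d → ℝ} {g : ℝ → ℝ} {β M τ ρ : ℝ} {x₀ : Eucl d}

lemma tsupport_cutoff_subset (hη : ∀ x, η x ≠ 0 → dist x x₀ < ρ)
    (hD : ∀ x ∈ Ω, profile g β M (D x) ≠ 0 → τ ≤ bdist Ω x) :
    tsupport (cutoff Ω η D g β M) ⊆ closure Ω ∩ closedBall x₀ ρ ∩ {x | τ ≤ bdist Ω x} := by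
  refine closure_minimal (fun x hx => ?_) ((isClosed_closure.inter isClosed_closedBall).inter
    (isClosed_le continuous_const (continuous_bdist Ω)))
  have hxΩ : x ∈ Ω := mem_of_indicator_ne_zero hx
  have h2 : η x * profile g β M (D x) ≠ 0 := by
    rwa [Function.mem_support, cutoff, indicator_of_mem hxΩ] at hx
  exact ⟨⟨subset_closure hxΩ, (hη x (left_ne_zero_of_mul h2)).le⟩, hD x hxΩ (right_ne_zero_of_mul h2)⟩

lemma mem_of_mem_closure_of_bdist_pos (ho : IsOpen Ω) {x : Eucl d} (hx : x ∈ closure Ω)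
    (h : 0 < bdist Ω x) : x ∈ Ω := by
  by_contra hcon
  have hf : x ∈ frontier Ω := by
    rw [ho.frontier_eq]
    exact ⟨hx, hcon⟩
  rw [bdist, infDist_zero_of_mem hf] at h
  exact h.false

/-- The support stays at distance at least `τ` from the boundary, so extension by zero preserves
smoothness, and there `D > 0`, where `profile` is smooth. -/
lemma cutoff_mem_testFunctions (ho : IsOpen Ω) {r : ℝ} (hx₀ : x₀ ∈ frontier Ω)
    (hτ : 0 < τ) (hρ : ρ < r) (hηc : ContDiff ℝ 1 η) (hDc : ContDiff ℝ 1 D) (hg : ContDiff ℝ 1 g)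
    (hη : ∀ x, η x ≠ 0 → dist x x₀ < ρ)
    (hD : ∀ x ∈ Ω, profile g β M (D x) ≠ 0 → τ ≤ bdist Ω x)
    (hpos : ∀ x, τ ≤ bdist Ω x → 0 < D x) :
    cutoff Ω η D g β M ∈ testFunctions (layer Ω r) := by
  have hsub := tsupport_cutoff_subset hη hD
  have hsubΩ : tsupport (cutoff Ω η D g β M) ⊆ Ω := fun x hx =>
    mem_of_mem_closure_of_bdist_pos ho (hsub hx).1.1 (hτ.trans_le (hsub hx).2)
  refine ⟨contDiff_iff_contDiffAt.2 fun x => ?_, ?_, fun x hx => ⟨hsubΩ hx, ?_⟩⟩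
  · by_cases hx : x ∈ tsupport (cutoff Ω η D g β M)
    · have h1 : ContDiffAt ℝ 1 (fun x => η x * profile g β M (D x)) x :=
        hηc.contDiffAt.mul ((contDiffAt_profile hg β M (hpos x (hsub hx).2)).comp x hDc.contDiffAt)
      refine h1.congr_of_eventuallyEq ?_
      filter_upwards [ho.mem_nhds (hsubΩ hx)] with y hy
      rw [cutoff, indicator_of_mem hy]
    · exact contDiffAt_const.congr_of_eventuallyEq (notMem_tsupport_iff_eventuallyEq.1 hx)
  · exact (isCompact_closedBall x₀ ρ).of_isClosed_subset (isClosed_tsupport _)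
      fun x hx => (hsub hx).1.2
  · exact ((infDist_le_dist_of_mem hx₀).trans (hsub hx).1.2).trans_lt hρ

/-- Pointwise bound of the gradient of the cut-off function. -/
lemma norm_fderiv_cutoff_le (ho : IsOpen Ω) {Cη Cg : ℝ} (hηc : ContDiff ℝ 1 η)
    (hDc : ContDiff ℝ 1 D) (hg : ContDiff ℝ 1 g) (hη1 : ∀ x, |η x| ≤ 1) (hg1 : ∀ v, |g v| ≤ 1)
    (hηC : ∀ x, ‖fderiv ℝ η x‖ ≤ Cη) (hgC : ∀ v, |deriv g v| ≤ Cg)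
    (hD1 : ∀ x, ‖fderiv ℝ D x‖ ≤ 1) (hβ : 0 ≤ β) (hM : 0 < M) {x : Eucl d} (hx : x ∈ Ω)
    (hDx : 0 < D x) :
    ‖fderiv ℝ (cutoff Ω η D g β M) x‖ ≤
      β * ((D x)⁻¹ * |cutoff Ω η D g β M x|) + (Cg / M * (D x)⁻¹ + Cη) * D x ^ (-β) := by
  have hev : cutoff Ω η D g β M =ᶠ[nhds x] fun x => η x * profile g β M (D x) := by
    filter_upwards [ho.mem_nhds hx] with y hy
    rw [cutoff, indicator_of_mem hy]
  have hp : HasDerivAt (profile g β M) (deriv (profile g β M) (D x)) (D x) :=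
    ((contDiffAt_profile hg β M hDx).differentiableAt one_ne_zero).hasDerivAt
  have h1 : HasFDerivAt (fun x => profile g β M (D x))
      (deriv (profile g β M) (D x) • fderiv ℝ D x) x :=
    hp.comp_hasFDerivAt x (hDc.differentiable one_ne_zero x).hasFDerivAt
  have h2 : HasFDerivAt (fun x => η x * profile g β M (D x))
      (η x • deriv (profile g β M) (D x) • fderiv ℝ D x + profile g β M (D x) • fderiv ℝ η x) x :=
    ((hηc.differentiable one_ne_zero x).hasFDerivAt).mul h1
  rw [hev.fderiv_eq, h2.fderiv, hev.eq_of_nhds]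
  have hM0 : 0 < D x ^ (-β) := Real.rpow_pos_of_pos hDx _
  have hCg : 0 ≤ Cg := (abs_nonneg _).trans (hgC 0)
  have hCη : 0 ≤ Cη := (norm_nonneg _).trans (hηC x)
  have hpd := abs_deriv_profile_le (hg.differentiable one_ne_zero) hβ hM hgC hDx
  have hpa : |profile g β M (D x)| ≤ D x ^ (-β) := by
    rw [profile, abs_mul, abs_of_pos hM0]
    exact mul_le_of_le_one_right hM0.le (hg1 _)
  calc _ ≤ |η x| * (|deriv (profile g β M) (D x)| * 1) + |profile g β M (D x)| * Cη := by
        refine (norm_add_le _ _).trans ?_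
        rw [norm_smul, norm_smul, norm_smul, Real.norm_eq_abs, Real.norm_eq_abs, Real.norm_eq_abs]
        gcongr
        · exact hD1 x
        · exact hηC x
    _ ≤ |η x| * ((D x)⁻¹ * (β * |profile g β M (D x)|)) +
        1 * ((D x)⁻¹ * (Cg / M * D x ^ (-β))) + D x ^ (-β) * Cη := by
        rw [mul_one]
        have : |η x| * |deriv (profile g β M) (D x)| ≤
            |η x| * ((D x)⁻¹ * (β * |profile g β M (D x)|)) +
              |η x| * ((D x)⁻¹ * (Cg / M * D x ^ (-β))) := by
          rw [← mul_add, ← mul_add]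
          gcongr
        refine add_le_add (this.trans ?_) (by gcongr)
        gcongr
        exact hη1 x
    _ = _ := by
        rw [abs_mul]
        ring

end cutoff

/-! ### Integrals over geometric shells -/

/-- Serves to replace the distance by the scale of its shell, whatever the sign of `p`. -/
lemma rpow_le_rpow_abs {x y p : ℝ} (hx : 0 < x) (hxy : x ≤ y) (hxy' : y⁻¹ ≤ x) :
    x ^ p ≤ y ^ |p| := by
  have hy : 0 < y := hx.trans_le hxy
  rcases le_total 0 p with hp | hp
  · rw [abs_of_nonneg hp]
    exact Real.rpow_le_rpow hx.le hxy hp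
  · rw [abs_of_nonpos hp, Real.rpow_neg hy.le, ← Real.inv_rpow hy.le]
    exact Real.rpow_le_rpow_of_nonpos (inv_pos.2 hy) hxy' hp

section shells

variable {d : ℕ} {b : Eucl d → ℝ} {W : Set (Eucl d)} {p : ℝ}

/-- Integration over geometric shells, upper bound. -/
lemma setLIntegral_shells_le {A c₁ c₂ q : ℝ} (hA : 0 ≤ A) (hc₁ : 0 ≤ c₁) (hc₂ : 0 ≤ c₂)
    (hb : Measurable b) (hW : MeasurableSet W) (hq : 1 < q)
    (hvol : ∀ t : ℝ, 0 < t → t < 2 → volume {x ∈ W | b x < t} ≤ ENNReal.ofReal (A * t ^ p))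
    (K : ℕ) :
    ∫⁻ x in {x ∈ W | (q⁻¹) ^ K ≤ b x ∧ b x < 1},
        ENNReal.ofReal ((c₁ + c₂ * b x) ^ 2 * b x ^ (-p)) ≤
      ENNReal.ofReal (∑ k ∈ Finset.range K, (c₁ + c₂ * (q⁻¹) ^ k) ^ 2 * (q ^ |p| * A)) := by
  have hq0 : 0 < q := by linarith
  induction K with
  | zero =>
    have : {x ∈ W | (q⁻¹) ^ 0 ≤ b x ∧ b x < 1} = ∅ := by
      ext x
      simp only [pow_zero, mem_ofPred_eq, mem_empty_iff_false, iff_false, not_and, not_lt]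
      exact fun _ h => h
    rw [this]
    simp
  | succ K ih =>
    set u := (q⁻¹) ^ K with hu
    have hu0 : 0 < u := by positivity
    have hu1 : u ≤ 1 := pow_le_one₀ (by positivity) (inv_le_one_of_one_le₀ hq.le)
    have hsub : {x ∈ W | (q⁻¹) ^ (K + 1) ≤ b x ∧ b x < 1} ⊆
        {x ∈ W | u ≤ b x ∧ b x < 1} ∪ {x ∈ W | u * q⁻¹ ≤ b x ∧ b x < u} := by
      rintro x ⟨hx, h1, h2⟩
      rcases le_or_gt u (b x) with h | h
      · exact Or.inl ⟨hx, h, h2⟩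
      · exact Or.inr ⟨hx, by rwa [pow_succ] at h1, h⟩
    rw [Finset.sum_range_succ, ← hu, 
      ENNReal.ofReal_add (Finset.sum_nonneg fun k _ => by positivity) (by positivity)]
    refine (lintegral_mono_set hsub).trans ((lintegral_union_le _ _ _).trans
      (add_le_add ih ?_))
    have hmeas : MeasurableSet {x ∈ W | u * q⁻¹ ≤ b x ∧ b x < u} :=
      hW.inter ((measurableSet_le measurable_const hb).inter (measurableSet_lt hb measurable_const))
    calc _ ≤ ∫⁻ x in {x ∈ W | u * q⁻¹ ≤ b x ∧ b x < u},
          ENNReal.ofReal ((c₁ + c₂ * u) ^ 2 * (q ^ |p| * u ^ (-p))) := by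
          refine setLIntegral_mono' hmeas fun x hx => ENNReal.ofReal_le_ofReal ?_
          have hbx : 0 < b x := lt_of_lt_of_le (by positivity) hx.2.1
          have h3 : (u / b x) ^ p ≤ q ^ |p| := by
            refine rpow_le_rpow_abs (by positivity) ?_ ?_
            · rw [div_le_iff₀ hbx]
              have := hx.2.1
              rw [← div_eq_mul_inv, div_le_iff₀ hq0] at this
              linarith
            · exact (inv_le_one_of_one_le₀ hq.le).trans ((one_le_div hbx).2 hx.2.2.le)
          have h4 : b x ^ (-p) = (u / b x) ^ p * u ^ (-p) := by
            rw [Real.div_rpow hu0.le hbx.le, Real.rpow_neg hbx.le, Real.rpow_neg hu0.le]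
            field_simp
          rw [h4]
          gcongr
          exact hx.2.2.le
      -- The factor `u ^ (-p)` cancels against the volume `A * u ^ p`, so the scale enters only
      -- through `c₁ + c₂ * u`.
      _ ≤ ENNReal.ofReal ((c₁ + c₂ * u) ^ 2 * (q ^ |p| * u ^ (-p))) * ENNReal.ofReal (A * u ^ p) := by
          rw [setLIntegral_const]
          gcongr
          exact le_trans (measure_mono (t := {x ∈ W | b x < u}) fun x hx => ⟨hx.1, hx.2.2⟩)
            (hvol u hu0 (by linarith))
      _ = _ := by
          rw [← ENNReal.ofReal_mul (by positivity)]
          congr 1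
          rw [Real.rpow_neg hu0.le]
          field_simp

/-- Integration over geometric shells, lower bound. -/
lemma le_setLIntegral_shells {c t σ q : ℝ} (hc : 0 ≤ c) (ht : 0 < t) (hσ : 1 ≤ σ)
    (hb : Measurable b) (hW : MeasurableSet W) (hq : 24 * σ ^ 2 < q)
    (hvol : ∀ u : ℝ, 0 < u → u ≤ t → ENNReal.ofReal (c * u ^ p) ≤
      volume {x ∈ W | u / (8 * σ) ≤ b x ∧ b x ≤ 3 * σ * u}) (K : ℕ) :
    ENNReal.ofReal (K * (((8 * σ) ^ |p|)⁻¹ * c)) ≤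
      ∫⁻ x in {x ∈ W | 3 * σ * (t * (q⁻¹) ^ K) < b x}, ENNReal.ofReal (b x ^ (-p)) := by
  have hσ0 : 0 < σ := by linarith
  have hq0 : 0 < q := lt_trans (by positivity) hq
  have hq1 : 1 ≤ q := by nlinarith
  induction K with
  | zero => simp
  | succ K ih =>
    set u := t * (q⁻¹) ^ K with hu
    have hu0 : 0 < u := by positivity
    have hut : u ≤ t := mul_le_of_le_one_right ht.le
      (pow_le_one₀ (by positivity) (inv_le_one_of_one_le₀ hq1))
    have hu1 : t * (q⁻¹) ^ (K + 1) = u * q⁻¹ := by rw [pow_succ, hu, mul_assoc]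
    rw [hu1]
    -- This is what `24 * σ ^ 2 < q` is for: the new shell lies above the next threshold, so each
    -- step adds a whole shell.
    have h24 : 3 * σ * (u * q⁻¹) < u / (8 * σ) := by
      rw [← div_eq_mul_inv, mul_div_assoc', div_lt_div_iff₀ hq0 (by positivity)]
      calc 3 * σ * u * (8 * σ) = u * (24 * σ ^ 2) := by ring
        _ < u * q := by gcongr
    set S := {x ∈ W | u / (8 * σ) ≤ b x ∧ b x ≤ 3 * σ * u}
    have hS : MeasurableSet S :=
      hW.inter ((measurableSet_le measurable_const hb).inter (measurableSet_le hb measurable_const))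
    have hdisj : Disjoint {x ∈ W | 3 * σ * u < b x} S :=
      Set.disjoint_left.2 fun x h1 h2 => (h1.2.trans_le h2.2.2).false
    have hsub : {x ∈ W | 3 * σ * u < b x} ∪ S ⊆ {x ∈ W | 3 * σ * (u * q⁻¹) < b x} := by
      rintro x (h | h)
      · refine ⟨h.1, lt_of_le_of_lt ?_ h.2⟩
        gcongr
        exact mul_le_of_le_one_right hu0.le (inv_le_one_of_one_le₀ hq1)
      · exact ⟨h.1, h24.trans_le h.2.1⟩
    refine le_trans ?_ (lintegral_mono_set hsub)
    rw [lintegral_union hS hdisj, Nat.cast_succ, add_mul, one_mul,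
      ENNReal.ofReal_add (by positivity) (by positivity)]
    refine add_le_add ih ?_
    calc _ = ENNReal.ofReal (((8 * σ) ^ |p|)⁻¹ * u ^ (-p)) * ENNReal.ofReal (c * u ^ p) := by
          rw [← ENNReal.ofReal_mul (by positivity)]
          congr 1
          rw [Real.rpow_neg hu0.le]
          field_simp
      _ ≤ ENNReal.ofReal (((8 * σ) ^ |p|)⁻¹ * u ^ (-p)) * volume S := by
          gcongr
          exact hvol u hu0 hut
      _ ≤ _ := by
          rw [← setLIntegral_const]
          refine setLIntegral_mono' hS fun x hx => ENNReal.ofReal_le_ofReal ?_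
          have hbx : 0 < b x := lt_of_lt_of_le (by positivity) hx.2.1
          have h3 : (b x / u) ^ p ≤ (8 * σ) ^ |p| := by
            refine rpow_le_rpow_abs (by positivity) ?_ ?_
            · rw [div_le_iff₀ hu0]
              have := hx.2.2
              nlinarith
            · rw [le_div_iff₀ hu0, ← div_eq_inv_mul]
              exact hx.2.1
          have h4 : b x ^ (-p) = ((b x / u) ^ p)⁻¹ * u ^ (-p) := by
            rw [Real.div_rpow hbx.le hu0.le, Real.rpow_neg hbx.le, Real.rpow_neg hu0.le]
            field_simp
          rw [h4]
          gcongr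

end shells

/-- The bound is uniform in `N`: about `2 * N` terms of size `(B / N) ^ 2` sum to a bounded
quantity, and the geometric part is summable. -/
lemma sum_geometric_error_le {q B c : ℝ} (hq : 2 ≤ q) {N : ℕ} (hN : 1 ≤ N) :
    ∑ k ∈ Finset.range (2 * N + 1), (B / N + c * (q⁻¹) ^ k) ^ 2 ≤ 6 * B ^ 2 + 4 * c ^ 2 := by
  have hN' : (1 : ℝ) ≤ N := by exact_mod_cast hN
  have hterm : ∀ k ∈ Finset.range (2 * N + 1), (B / N + c * (q⁻¹) ^ k) ^ 2 ≤
      2 * B ^ 2 / N ^ 2 + 2 * c ^ 2 * (1 / 2) ^ k := fun k _ => by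
    have h1 : ((q⁻¹) ^ k) ^ 2 ≤ (1 / 2 : ℝ) ^ k := by
      have h2 : q⁻¹ ≤ 1 / 2 := by
        rw [one_div]
        exact inv_anti₀ two_pos hq
      have h3 : 0 ≤ q⁻¹ := by positivity
      calc ((q⁻¹) ^ k) ^ 2 ≤ (q⁻¹) ^ k := by
            rw [sq]
            exact mul_le_of_le_one_right (by positivity) (pow_le_one₀ h3 (by linarith))
        _ ≤ _ := by gcongr
    have h4 : c ^ 2 * ((q⁻¹) ^ k) ^ 2 ≤ c ^ 2 * (1 / 2) ^ k := by gcongr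
    have h5 := sq_nonneg (B / N - c * (q⁻¹) ^ k)
    have h6 : 2 * B ^ 2 / N ^ 2 = 2 * (B / N) ^ 2 := by rw [div_pow]; ring
    rw [h6]
    nlinarith
  refine (Finset.sum_le_sum hterm).trans ?_
  rw [Finset.sum_add_distrib, ← Finset.mul_sum, Finset.sum_const, Finset.card_range, nsmul_eq_mul]
  have h7 : ∑ k ∈ Finset.range (2 * N + 1), (1 / 2 : ℝ) ^ k ≤ 2 := sum_geometric_two_le _
  have h8 : ((2 * N + 1 : ℕ) : ℝ) * (2 * B ^ 2 / N ^ 2) ≤ 6 * B ^ 2 := by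
    rw [mul_div_assoc', div_le_iff₀ (by positivity)]
    push_cast
    have : (2 * N + 1 : ℝ) ≤ 3 * N ^ 2 := by nlinarith
    nlinarith [mul_le_mul_of_nonneg_right this (sq_nonneg B)]
  have h9 : 2 * c ^ 2 * ∑ k ∈ Finset.range (2 * N + 1), (1 / 2 : ℝ) ^ k ≤ 2 * c ^ 2 * 2 := by gcongr
  linarith

/-! ### Test functions and the Hardy constant -/

lemma rpow_half_sq {x : ℝ} (hx : 0 < x) (y : ℝ) : (x ^ (y / 2)) ^ 2 = x ^ y := by
  rw [← Real.rpow_natCast, ← Real.rpow_mul hx.le]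
  congr 1
  push_cast
  ring

/-- A pointwise bound of the weighted gradient gives, by Minkowski's inequality, a bound of the
weighted gradient norm. -/
lemma gradNorm_le_of_pointwise {d : ℕ} {Ω : Set (Eucl d)} (ho : IsOpen Ω)
    (hne : (frontier Ω).Nonempty) {δ r β : ℝ} (hβ : 0 ≤ β) {ψ H : Eucl d → ℝ}
    (hψ : Measurable ψ) (hH : Measurable H) (hH0 : ∀ x, 0 ≤ H x)
    (hle : ∀ x ∈ layer Ω r, bdist Ω x ^ (δ / 2) * ‖fderiv ℝ ψ x‖ ≤
      β * (bdist Ω x ^ ((δ - 2) / 2) * |ψ x|) + H x) :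
    gradNorm Ω δ r ψ ≤ ENNReal.ofReal β * weightNorm Ω δ r ψ +
      (∫⁻ x, ENNReal.ofReal (H x ^ 2)) ^ (1 / 2 : ℝ) := by
  have hlayer : MeasurableSet (layer Ω r) := ho.measurableSet.inter
    (isOpen_lt (continuous_bdist Ω) continuous_const).measurableSet
  have hb : Measurable (bdist Ω) := (continuous_bdist Ω).measurable
  set F : Eucl d → ℝ≥0∞ := fun x =>
    ENNReal.ofReal (β * (bdist Ω x ^ ((δ - 2) / 2) * |ψ x|)) with hF
  set G : Eucl d → ℝ≥0∞ := fun x => ENNReal.ofReal (H x) with hG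
  have hFm : Measurable F := by
    refine (measurable_const.mul ((hb.pow_const _).mul ?_)).ennreal_ofReal
    exact measurable_norm.comp hψ
  have hGm : Measurable G := hH.ennreal_ofReal
  have hFG := ENNReal.lintegral_Lp_add_le (μ := volume.restrict (layer Ω r)) hFm.aemeasurable
    hGm.aemeasurable one_le_two
  have h1 : gradNorm Ω δ r ψ ≤ (∫⁻ x in layer Ω r, (F + G) x ^ (2 : ℝ)) ^ (1 / 2 : ℝ) := by
    refine ENNReal.rpow_le_rpow (setLIntegral_mono' hlayer fun x hx => ?_) (by norm_num)
    have hbx := bdist_pos ho hne hx.1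
    rw [Pi.add_apply, hF, hG, ← ENNReal.ofReal_add (by positivity) (hH0 x),
      ENNReal.ofReal_rpow_of_nonneg (add_nonneg (by positivity) (hH0 x)) zero_le_two,
      Real.rpow_two, ← rpow_half_sq hbx, ← mul_pow]
    exact ENNReal.ofReal_le_ofReal (pow_le_pow_left₀ (by positivity) (hle x hx) 2)
  have h2 : (∫⁻ x in layer Ω r, F x ^ (2 : ℝ)) ^ (1 / 2 : ℝ) =
      ENNReal.ofReal β * weightNorm Ω δ r ψ := by
    have h3 : ∫⁻ x in layer Ω r, F x ^ (2 : ℝ) = ENNReal.ofReal (β ^ 2) *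
        ∫⁻ x in layer Ω r, ENNReal.ofReal (bdist Ω x ^ (δ - 2) * |ψ x| ^ 2) := by
      rw [← lintegral_const_mul' _ _ ENNReal.ofReal_ne_top]
      refine setLIntegral_congr_fun hlayer fun x hx => ?_
      have hbx := bdist_pos ho hne hx.1
      rw [hF, ENNReal.ofReal_rpow_of_nonneg (by positivity) zero_le_two,
        ← ENNReal.ofReal_mul (by positivity), Real.rpow_two, mul_pow, mul_pow, rpow_half_sq hbx]
    rw [h3, ENNReal.mul_rpow_of_nonneg _ _ (by norm_num), weightNorm,
      ENNReal.ofReal_rpow_of_nonneg (by positivity) (by norm_num), ← Real.sqrt_eq_rpow,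
      Real.sqrt_sq hβ]
  refine h1.trans (hFG.trans (add_le_add h2.le ?_))
  refine ENNReal.rpow_le_rpow ((setLIntegral_le_lintegral _ _).trans (lintegral_mono fun x => ?_))
    (by norm_num)
  rw [hG, ENNReal.ofReal_rpow_of_nonneg (hH0 x) zero_le_two, Real.rpow_two]

/-- Test functions in the boundary layer which almost realize the quotient
`(d - s + δ - 2) / 2`. -/
lemma IsUniformDomain.exists_testFunction {d : ℕ} {Ω : Set (Eucl d)} (hΩ : IsUniformDomain Ω)
    {s δ : ℝ} (hne : (frontier Ω).Nonempty) (hreg : IsAhlforsRegular (frontier Ω) s)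
    (hδ : 2 - ((d : ℝ) - s) < δ) {r : ℝ} (hr : 0 < r) :
    ∃ C c : ℝ, 0 < c ∧ ∀ K : ℕ, ∃ ψ ∈ testFunctions (layer Ω r),
      gradNorm Ω δ r ψ ≤
        ENNReal.ofReal (((d : ℝ) - s + δ - 2) / 2) * weightNorm Ω δ r ψ +
          ENNReal.ofReal C ^ (1 / 2 : ℝ) ∧
      ENNReal.ofReal (K * c) ^ (1 / 2 : ℝ) ≤ weightNorm Ω δ r ψ := by
  have ho := hΩ.isOpen
  obtain ⟨x₀, hx₀⟩ := hne
  set p : ℝ := (d : ℝ) - s with hp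
  set β : ℝ := (p + δ - 2) / 2 with hβdef
  have hβ : 0 < β := by rw [hβdef]; linarith
  obtain ⟨σ, hσ, R₀, hR₀, hlower⟩ := hΩ.le_volume_shell hreg hx₀
  have hσ0 : 0 < σ := by linarith
  set R : ℝ := min R₀ (min r 1 / (32 * σ)) with hRdef
  have hR : 0 < R := by positivity
  have hσR : σ * R ≤ min r 1 / 32 := by
    have : R ≤ min r 1 / (32 * σ) := min_le_right _ _
    rw [le_div_iff₀ (by positivity)] at this
    linarith
  have hσRr : 8 * σ * R < r := by linarith [min_le_left r 1]
  have hσR1 : 8 * σ * R ≤ 1 / 4 := by linarith [min_le_right r 1]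
  have hR1 : R ≤ 1 := by nlinarith
  obtain ⟨c, hc, hlower⟩ := hlower R hR (min_le_left _ _)
  obtain ⟨A, hA, hupper⟩ := hreg.volume_neighborhood_le isClosed_frontier hx₀ (R := 2 * (8 * σ * R))
    (T := 2) (by positivity) two_pos
  let η : ContDiffBump x₀ := ⟨4 * σ * R, 8 * σ * R, by positivity, by nlinarith [mul_pos hσ0 hR]⟩
  let g : ContDiffBump (0 : ℝ) := ⟨1, 2, one_pos, one_lt_two⟩
  obtain ⟨Cη, hCη⟩ := ContDiff.lipschitzWith_of_hasCompactSupport (𝕂 := ℝ) η.hasCompactSupport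
    (η.contDiff (n := 1)) one_ne_zero
  obtain ⟨Cg, hCg⟩ := ContDiff.lipschitzWith_of_hasCompactSupport (𝕂 := ℝ) g.hasCompactSupport
    (g.contDiff (n := 1)) one_ne_zero
  -- The ratio exceeds `24 * σ ^ 2`, and dividing by `R` makes one extra factor of `q` absorb the
  -- initial scale of the lower shells.
  set q : ℝ := 32 * σ ^ 2 / R with hq
  have hq32 : 32 * σ ^ 2 ≤ q := by
    rw [hq, le_div_iff₀ hR]
    exact mul_le_of_le_one_right (by positivity) hR1
  have hq2 : 2 ≤ q := by nlinarith
  have hq1 : 1 < q := by linarith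
  have hq0 : 0 < q := by linarith
  have hlogq : 0 < Real.log q := Real.log_pos hq1
  refine ⟨(6 * (Cg / Real.log q) ^ 2 + 4 * (Cη : ℝ) ^ 2) * (q ^ |p| * A),
    2 ^ (-(2 * β)) * (((8 * σ) ^ |p|)⁻¹ * c), by positivity, fun K => ?_⟩
  -- The extra shell ensures that the `K` shells of the lower bound lie in `{q⁻¹ ^ N ≤ b}`, where
  -- the cut-off equals one.
  obtain ⟨N, hNK⟩ : ∃ N, N = K + 1 := ⟨_, rfl⟩
  have hN : 1 ≤ N := by omega
  have hN0 : (0 : ℝ) < N := by exact_mod_cast hN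
  -- For small `D`, the profile is uncut when `D ≥ q⁻¹ ^ N` and vanishes when `D ≤ q⁻¹ ^ (2 * N) = 2
  -- * τ`.
  set M : ℝ := N * Real.log q with hMdef
  have hM : 0 < M := by positivity
  set τ : ℝ := (q⁻¹) ^ (2 * N) / 2 with hτdef
  have hτ : 0 < τ := by positivity
  have hexp : Real.exp (-(2 * M)) = 2 * τ := by
    rw [hτdef, hMdef, mul_div_cancel₀ _ two_ne_zero, inv_pow, Real.exp_neg, ← mul_assoc,
      show (2 : ℝ) * N = ((2 * N : ℕ) : ℝ) by push_cast; rfl, mul_comm, Real.exp_mul,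
      Real.exp_log hq0, Real.rpow_natCast]
  have hexp1 : Real.exp (-M) = (q⁻¹) ^ N := by
    rw [hMdef, inv_pow, Real.exp_neg, mul_comm, Real.exp_mul, Real.exp_log hq0, Real.rpow_natCast]
  obtain ⟨D₀, hD₀c, hD₀, hD₀1⟩ := exists_contDiff_approx (lipschitzWith_bdist Ω) (half_pos hτ)
  -- The shift gives `b ≤ D ≤ b + τ`: the lower bound controls negative powers of `D` by those of
  -- `b`, and the upper bound turns `D > 2 * τ` into `b > τ`.
  set D : Eucl d → ℝ := fun x => D₀ x + τ / 2 with hD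
  have hDc : ContDiff ℝ 1 D := hD₀c.add contDiff_const
  have hD1 : ∀ x, ‖fderiv ℝ D x‖ ≤ 1 := fun x => by
    rw [hD, fderiv_add_const]
    exact hD₀1 x
  have hbD : ∀ x, bdist Ω x ≤ D x := fun x => by
    have := (abs_le.1 (hD₀ x)).1
    simp only [hD]
    linarith
  have hDb : ∀ x, D x ≤ bdist Ω x + τ := fun x => by
    have := (abs_le.1 (hD₀ x)).2
    simp only [hD]
    linarith
  have hηsupp : ∀ x, η x ≠ 0 → dist x x₀ < 8 * σ * R := fun x hx => by
    have : x ∈ Function.support η := hx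
    rwa [η.support_eq] at this
  have hDsupp : ∀ x ∈ Ω, profile g β M (D x) ≠ 0 → τ ≤ bdist Ω x := fun x hx h => by
    have hDx : 0 < D x := (bdist_pos ho ⟨x₀, hx₀⟩ hx).trans_le (hbD x)
    have h1 : Real.log (D x) / M ∈ Function.support g := right_ne_zero_of_mul h
    rw [g.support_eq, mem_ball, Real.dist_eq, sub_zero] at h1
    have h2 : -2 < Real.log (D x) / M := (abs_lt.1 h1).1
    rw [lt_div_iff₀ hM] at h2
    have h3 : 2 * τ < D x := by
      rw [← hexp, ← Real.lt_log_iff_exp_lt hDx]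
      linarith
    linarith [hDb x]
  have hDpos : ∀ x, τ ≤ bdist Ω x → 0 < D x := fun x hx => hτ.trans_le (hx.trans (hbD x))
  set ψ := cutoff Ω η D g β M with hψ
  have hψmem : ψ ∈ testFunctions (layer Ω r) := cutoff_mem_testFunctions ho hx₀ hτ hσRr
    η.contDiff hDc g.contDiff hηsupp hDsupp hDpos
  have hsupp := tsupport_cutoff_subset (M := M) hηsupp hDsupp
  have hbm : Measurable (bdist Ω) := (continuous_bdist Ω).measurable
  refine ⟨ψ, hψmem, ?_, ?_⟩
  -- The exponent is `2 * N + 1` because `τ` is half of `q⁻¹ ^ (2 * N)` and `q ≥ 2`.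
  · set T := {x ∈ ball x₀ (2 * (8 * σ * R)) | (q⁻¹) ^ (2 * N + 1) ≤ bdist Ω x ∧ bdist Ω x < 1}
    have hT : MeasurableSet T := measurableSet_ball.inter
      ((measurableSet_le measurable_const hbm).inter (measurableSet_lt hbm measurable_const))
    set H₀ : Eucl d → ℝ := fun x =>
      (Cg / Real.log q / N + Cη * bdist Ω x) * bdist Ω x ^ (-p / 2) with hH₀
    have hH₀m : Measurable H₀ := by
      exact (measurable_const.add (hbm.const_mul _)).mul (hbm.pow_const _)
    have hH₀0 : ∀ x, 0 ≤ H₀ x := fun x => by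
      have := bdist_nonneg Ω x
      positivity
    refine (gradNorm_le_of_pointwise (H := T.indicator H₀) ho ⟨x₀, hx₀⟩ hβ.le
      hψmem.1.continuous.measurable (hH₀m.indicator hT)
      (fun x => indicator_nonneg (fun y _ => hH₀0 y) x) fun x hx => ?_).trans
      (add_le_add le_rfl (ENNReal.rpow_le_rpow ?_ (by norm_num)))
    · have hb := bdist_pos ho ⟨x₀, hx₀⟩ hx.1
      by_cases hxs : x ∈ tsupport ψ
      · obtain ⟨⟨-, hxball⟩, hxτ⟩ := hsupp hxs
        have hxτ : τ ≤ bdist Ω x := hxτ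
        have hxT : x ∈ T := by
          refine ⟨(mem_closedBall.1 hxball).trans_lt (by linarith [show 0 < 8 * σ * R by positivity]),
            le_trans ?_ hxτ, ?_⟩
          · rw [pow_succ, hτdef, div_eq_mul_inv]
            gcongr
          · have : bdist Ω x ≤ dist x x₀ := infDist_le_dist_of_mem hx₀
            linarith [mem_closedBall.1 hxball]
        have hDx := hDpos x hxτ
        rw [indicator_of_mem hxT]
        have hgrad := norm_fderiv_cutoff_le (Cη := Cη) (Cg := Cg) (M := M) ho η.contDiff hDc
          g.contDiff (fun x => by rw [abs_of_nonneg η.nonneg]; exact η.le_one)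
          (fun v => by rw [abs_of_nonneg g.nonneg]; exact g.le_one)
          (fun x => norm_fderiv_le_of_lipschitz ℝ hCη)
          (fun v => norm_deriv_le_of_lipschitz hCg) hD1 hβ.le hM hx.1 hDx
        have hinv : (D x)⁻¹ ≤ (bdist Ω x)⁻¹ := inv_anti₀ hb (hbD x)
        have hpow : D x ^ (-β) ≤ bdist Ω x ^ (-β) :=
          Real.rpow_le_rpow_of_nonpos hb (hbD x) (by linarith)
        have e1 : bdist Ω x ^ ((δ - 2) / 2) = bdist Ω x ^ (δ / 2) * (bdist Ω x)⁻¹ := by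
          rw [← Real.rpow_neg_one, ← Real.rpow_add hb]
          congr 1
          ring
        have e2 : bdist Ω x ^ (-p / 2) =
            bdist Ω x ^ (δ / 2) * (bdist Ω x)⁻¹ * bdist Ω x ^ (-β) := by
          rw [← Real.rpow_neg_one, ← Real.rpow_add hb, ← Real.rpow_add hb]
          congr 1
          rw [hβdef]
          ring
        calc _ ≤ bdist Ω x ^ (δ / 2) * (β * ((bdist Ω x)⁻¹ * |ψ x|) +
              (Cg / M * (bdist Ω x)⁻¹ + Cη) * bdist Ω x ^ (-β)) := by
              refine mul_le_mul_of_nonneg_left (hgrad.trans ?_) (by positivity)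
              gcongr
          _ = _ := by
              simp only [hH₀]
              rw [e1, e2, hMdef]
              field_simp
      · have h0 : ψ =ᶠ[nhds x] 0 := notMem_tsupport_iff_eventuallyEq.1 hxs
        have h1 : fderiv ℝ ψ x = 0 := by
          rw [h0.fderiv_eq]
          exact fderiv_const_apply 0
        rw [h1, norm_zero, mul_zero]
        exact add_nonneg (by positivity) (indicator_nonneg (fun y _ => hH₀0 y) x)
    · have h1 : ∀ x, ENNReal.ofReal (T.indicator H₀ x ^ 2) =
          T.indicator (fun x => ENNReal.ofReal (H₀ x ^ 2)) x := fun x => by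
        by_cases hx : x ∈ T <;> simp [hx]
      simp_rw [h1]
      rw [lintegral_indicator hT]
      have h2 : ∫⁻ x in T, ENNReal.ofReal (H₀ x ^ 2) = ∫⁻ x in T, ENNReal.ofReal
          ((Cg / Real.log q / N + Cη * bdist Ω x) ^ 2 * bdist Ω x ^ (-p)) := by
        refine setLIntegral_congr_fun hT fun x hx => ?_
        have hb : 0 < bdist Ω x := lt_of_lt_of_le (by positivity) hx.2.1
        simp only [hH₀]
        rw [mul_pow, rpow_half_sq hb]
      rw [h2]
      refine (setLIntegral_shells_le hA.le (by positivity) (by positivity) hbm measurableSet_ball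
        hq1 hupper (2 * N + 1)).trans (ENNReal.ofReal_le_ofReal ?_)
      rw [← Finset.sum_mul]
      have := sum_geometric_error_le (B := Cg / Real.log q) (c := Cη) hq2 hN
      gcongr
  · refine ENNReal.rpow_le_rpow ?_ (by norm_num)
    have hlow := le_setLIntegral_shells (b := bdist Ω) (W := Ω ∩ ball x₀ (4 * σ * R)) (p := p)
      (q := q) (t := R / 2) hc.le (by positivity) hσ hbm
      (ho.measurableSet.inter measurableSet_ball) (by nlinarith)
      (fun u hu hut => hlower u hu (by linarith)) K
    set L := {x ∈ Ω ∩ ball x₀ (4 * σ * R) | 3 * σ * (R / 2 * (q⁻¹) ^ K) < bdist Ω x}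
    have hL : MeasurableSet L := (ho.measurableSet.inter measurableSet_ball).inter
      (measurableSet_lt measurable_const hbm)
    have hbdist : ∀ x ∈ L, bdist Ω x < 4 * σ * R := fun x hx =>
      (infDist_le_dist_of_mem hx₀ : bdist Ω x ≤ dist x x₀).trans_lt (mem_ball.1 hx.1.2)
    have hLlayer : L ⊆ layer Ω r := fun x hx =>
      ⟨hx.1.1, (hbdist x hx).trans (by linarith [mul_pos hσ0 hR])⟩
    calc ENNReal.ofReal (K * (2 ^ (-(2 * β)) * (((8 * σ) ^ |p|)⁻¹ * c)))
        = ENNReal.ofReal (2 ^ (-(2 * β))) *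
            ENNReal.ofReal (K * (((8 * σ) ^ |p|)⁻¹ * c)) := by
          rw [← ENNReal.ofReal_mul (by positivity)]
          congr 1
          ring
      _ ≤ ENNReal.ofReal (2 ^ (-(2 * β))) * ∫⁻ x in L, ENNReal.ofReal (bdist Ω x ^ (-p)) := by
          gcongr
      _ = ∫⁻ x in L, ENNReal.ofReal (2 ^ (-(2 * β)) * bdist Ω x ^ (-p)) := by
          rw [← lintegral_const_mul' _ _ ENNReal.ofReal_ne_top]
          simp_rw [ENNReal.ofReal_mul (show (0 : ℝ) ≤ 2 ^ (-(2 * β)) by positivity)]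
      _ ≤ ∫⁻ x in L, ENNReal.ofReal (bdist Ω x ^ (δ - 2) * |ψ x| ^ 2) := by
          refine setLIntegral_mono' hL fun x hx => ENNReal.ofReal_le_ofReal ?_
          have hb := bdist_pos ho ⟨x₀, hx₀⟩ hx.1.1
          have hqb : (q⁻¹) ^ N ≤ bdist Ω x := by
            refine le_trans ?_ hx.2.le
            have h1 : 1 ≤ 3 * σ * (R / 2) * q := by
              have : 3 * σ * (R / 2) * q = 48 * σ ^ 3 := by
                rw [hq]
                field_simp
                norm_num
              rw [this]
              nlinarith [one_le_pow₀ hσ (n := 3)]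
            calc (q⁻¹) ^ N = 1 * (q⁻¹) ^ N := (one_mul _).symm
              _ ≤ 3 * σ * (R / 2) * q * (q⁻¹) ^ N := by gcongr
              _ = _ := by
                rw [hNK, pow_succ]
                field_simp
          have hτb : τ ≤ bdist Ω x := by
            refine le_trans ?_ hqb
            have h2 : (q⁻¹) ^ (2 * N) ≤ (q⁻¹) ^ N :=
              pow_le_pow_of_le_one (by positivity) (inv_le_one_of_one_le₀ hq1.le) (by omega)
            have h3 : 0 ≤ (q⁻¹) ^ (2 * N) := by positivity
            rw [hτdef]
            linarith
          have hDx := hDpos x hτb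
          -- From `D ≤ b + τ` and `τ ≤ b`; this is the source of the factor `2 ^ (-(2 * β))`.
          have hD2 : D x ≤ 2 * bdist Ω x := by linarith [hDb x]
          have hDlt : D x ≤ 1 := by linarith [hbdist x hx]
          have hη1 : η x = 1 := η.one_of_mem_closedBall (ball_subset_closedBall hx.1.2)
          have hg1 : g (Real.log (D x) / M) = 1 := by
            refine g.one_of_mem_closedBall ?_
            rw [mem_closedBall, Real.dist_eq, sub_zero]
            refine abs_le.2 ⟨?_, ?_⟩
            · change -1 ≤ _
              rw [le_div_iff₀ hM, neg_one_mul, Real.le_log_iff_exp_le hDx, hexp1]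
              exact hqb.trans (hbD x)
            · exact (div_nonpos_of_nonpos_of_nonneg (Real.log_nonpos hDx.le hDlt) hM.le).trans
                zero_le_one
          have hψx : ψ x = D x ^ (-β) := by
            rw [hψ, cutoff, indicator_of_mem hx.1.1, hη1, profile, hg1]
            ring
          rw [hψx, abs_of_pos (Real.rpow_pos_of_pos hDx _)]
          have hpow : (2 * bdist Ω x) ^ (-β) ≤ D x ^ (-β) :=
            Real.rpow_le_rpow_of_nonpos hDx hD2 (by linarith)
          calc _ = bdist Ω x ^ (δ - 2) * ((2 * bdist Ω x) ^ (-β)) ^ 2 := by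
                rw [← Real.rpow_natCast, ← Real.rpow_mul (by positivity),
                  Real.mul_rpow two_pos.le hb.le, mul_left_comm, ← Real.rpow_add hb]
                congr 2
                · push_cast
                  ring
                · rw [hβdef]
                  push_cast
                  ring
            _ ≤ _ := by gcongr
      _ ≤ _ := lintegral_mono_set hLlayer

-- For each fixed `r` the gradient error is bounded independently of `K` while the weighted norm
-- tends to infinity, so the error disappears from the quotient.
open Filter Topology in
lemma IsUniformDomain.hardyConstant_le {d : ℕ} {Ω : Set (Eucl d)} (hΩ : IsUniformDomain Ω)
    {s δ : ℝ} (hne : (frontier Ω).Nonempty) (hreg : IsAhlforsRegular (frontier Ω) s)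
    (hδ : 2 - ((d : ℝ) - s) < δ) :
    hardyConstant Ω δ ≤ ENNReal.ofReal (((d : ℝ) - s + δ - 2) / 2) := by
  refine iSup₂_le fun r hr => ?_
  obtain ⟨C, c, hc, h⟩ := hΩ.exists_testFunction hne hreg hδ hr
  set β := ENNReal.ofReal (((d : ℝ) - s + δ - 2) / 2)
  set C' := ENNReal.ofReal C ^ (1 / 2 : ℝ)
  have hC' : C' ≠ ∞ := ENNReal.rpow_ne_top_of_nonneg (by norm_num) ENNReal.ofReal_ne_top
  have hbound : ∀ K : ℕ, 1 ≤ K →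
      (⨅ (ψ : Eucl d → ℝ) (_ : ψ ∈ testFunctions (layer Ω r)) (_ : ψ ≠ 0),
        gradNorm Ω δ r ψ / weightNorm Ω δ r ψ) ≤
      β + C' / ENNReal.ofReal (K * c) ^ (1 / 2 : ℝ) := fun K hK => by
    obtain ⟨ψ, hψ, hgrad, hweight⟩ := h K
    have hK0 : (0 : ℝ) < K := by exact_mod_cast hK
    have hpos : 0 < weightNorm Ω δ r ψ := lt_of_lt_of_le
      (ENNReal.rpow_pos (ENNReal.ofReal_pos.2 (by positivity)) ENNReal.ofReal_ne_top) hweight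
    have hψ0 : ψ ≠ 0 := by
      rintro rfl
      simp [weightNorm] at hpos
    refine (iInf₂_le_of_le ψ hψ (iInf_le _ hψ0)).trans ?_
    calc _ ≤ (β * weightNorm Ω δ r ψ + C') / weightNorm Ω δ r ψ := by gcongr
      _ = β * (weightNorm Ω δ r ψ / weightNorm Ω δ r ψ) + C' / weightNorm Ω δ r ψ := by
          rw [ENNReal.add_div, mul_div_assoc]
      -- An inequality suffices here, so finiteness of the weighted norm need not be shown.
      _ ≤ β * 1 + C' / weightNorm Ω δ r ψ := by
          gcongr
          exact ENNReal.div_self_le_one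
      _ ≤ _ := by
          rw [mul_one]
          gcongr
  have hlim : Tendsto (fun K : ℕ => β + C' / ENNReal.ofReal (K * c) ^ (1 / 2 : ℝ)) atTop
      (𝓝 (β + 0)) := by
    refine tendsto_const_nhds.add ?_
    have h1 : Tendsto (fun K : ℕ => ENNReal.ofReal (K * c) ^ (1 / 2 : ℝ)) atTop (𝓝 ∞) :=
      (ENNReal.tendsto_rpow_at_top (by norm_num)).comp
        (ENNReal.tendsto_ofReal_atTop.comp (tendsto_natCast_atTop_atTop.atTop_mul_const hc))
    have h2 := ENNReal.Tendsto.const_div h1 (Or.inr hC')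
    rwa [ENNReal.div_top] at h2
  rw [add_zero] at hlim
  exact ge_of_tendsto hlim (eventually_atTop.2 ⟨1, hbound⟩)

end BoundaryHardy

theorem proposition6p4 (d : ℕ) (Ω : Set (BoundaryHardy.Eucl d)) (s δ : ℝ)
    (hΩ : BoundaryHardy.IsUniformDomain Ω)
    (hne : (frontier Ω).Nonempty)
    (hreg : BoundaryHardy.IsAhlforsRegular (frontier Ω) s)
    (hδ : 2 - ((d : ℝ) - s) < δ)
    (hHardy : ∃ r : ℝ, 0 < r ∧ ∃ b : ℝ, 0 < b ∧ BoundaryHardy.HardyInequality Ω δ r b) :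
    dimH (frontier Ω) = ENNReal.ofReal s ∧
      BoundaryHardy.hardyConstant Ω δ ≤
        ENNReal.ofReal (((d : ℝ) - (dimH (frontier Ω)).toReal + δ - 2) / 2) := by
  have hdim := hreg.dimH_eq isClosed_frontier hne
  refine ⟨hdim, ?_⟩
  rw [hdim, ENNReal.toReal_ofReal hreg.1.le]
  exact hΩ.hardyConstant_le hne hreg hδ
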